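/- Let $R$ be a regular commutative ring, that is, a commutative Noetherian ring whose localization $R_P$ at every prime ideal $P$ is a regular local ring, and let $E$ be an $R$-module. Suppose that $\operatorname{Ext}^1_R(R/J, E) = 0$ for every ideal $J$ of $R$ generated by an $R$-regular sequence, i.e. $J = (x_1,\dots,x_g)$ with $J \neq R$ and $x_i$ a nonzerodivisor on $R/(x_1,\dots,x_{i-1})$ for $i = 1,\dots,g$. Then $E$ is an injective $R$-module. -/

import Mathlib

universe u

/-!
As `R` is Noetherian, every `R`-linear map from an ideal of `R` to `E` has a maximal extension `f`,
defined on an ideal `I`. If `I ≠ R`, choose an associated prime `P = (I : c)` of `R / I`.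
Since `R_P` is regular, there are a regular sequence `xs` in `P` and `s ∉ P` with `s P ⊆ (xs)`:
the ideal generated by a regular sequence in `R` is unmixed, so prime avoidance keeps producing
elements of `P` that are regular modulo the previous ones and are part of a minimal system of
generators of the maximal ideal of `R_P`. The vanishing of `Ext¹(R / (xs), E)` gives `e` with
`f (j c) = j e` for all `j ∈ (xs)`, so `f` extends to `I + (s c)` by `s c ↦ s e`, although
`s c ∉ I`; this contradicts maximality.
-/

open CategoryTheory Abelian IsLocalRing RingTheory.Sequence

theorem exists_forall_eq_smul_of_subsingleton_ext_one {R : Type u} [CommRing R] {E : Type u}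
    [AddCommGroup E] [Module R E] {J : Ideal R}
    (h : Subsingleton (Ext (ModuleCat.of R (R ⧸ J)) (ModuleCat.of R E) 1)) (g : J →ₗ[R] E) :
    ∃ e : E, ∀ j : J, g j = (j : R) • e := by
  let S : ShortComplex (ModuleCat.{u} R) :=
    ModuleCat.shortComplexOfCompEqZero J.subtype J.mkQ
      (LinearMap.exact_subtype_mkQ J).linearMap_comp_eq_zero
  have hS : S.ShortExact := ModuleCat.shortComplex_shortExact S
    (LinearMap.exact_subtype_mkQ J) J.injective_subtype (Submodule.mkQ_surjective _)
  obtain ⟨x, hx⟩ := Ext.contravariant_sequence_exact₁ hS (Y := ModuleCat.of R E)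
    (Ext.mk₀ (ModuleCat.ofHom g)) (n₁ := 1) rfl (h.elim _ _)
  obtain ⟨φ, rfl⟩ := Ext.addEquiv₀.symm.surjective x
  have hφ : S.f ≫ φ = ModuleCat.ofHom g := by
    apply Ext.addEquiv₀.symm.injective
    simpa using hx
  refine ⟨φ.hom (1 : R), fun j ↦ ?_⟩
  have hj : φ.hom (j : R) = g j := ConcreteCategory.congr_hom hφ j
  rw [← map_smul φ.hom, smul_eq_mul, mul_one, hj]

theorem exists_le_linearPMap_mem_domain {R M F : Type*} [Ring R] [AddCommGroup M] [Module R M]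
    [AddCommGroup F] [Module R F] (f : M →ₗ.[R] F) {x : M} {y : F}
    (h : ∀ (r : R) (hr : r • x ∈ f.domain), f ⟨r • x, hr⟩ = r • y) :
    ∃ g : M →ₗ.[R] F, f ≤ g ∧ x ∈ g.domain := by
  let k : M →ₗ.[R] F := .mkSpanSingleton' x y fun r hr ↦ by
    have hmem : r • x ∈ f.domain := hr ▸ zero_mem _
    rw [RingHom.id_apply, ← h r hmem, ← f.map_zero]
    congr
  have hfk : ∀ (a : f.domain) (b : k.domain), (a : M) = b → f a = k b := by
    rintro ⟨_, ha⟩ ⟨_, hb⟩ rfl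
    obtain ⟨r, rfl⟩ := Submodule.mem_span_singleton.mp hb
    rw [h, LinearPMap.mkSpanSingleton'_apply, RingHom.id_apply]
  refine ⟨f.sup k hfk, f.left_le_sup k hfk, ?_⟩
  rw [LinearPMap.domain_sup]
  exact Submodule.mem_sup_right (Submodule.mem_span_singleton_self x)

section Baer

variable {R E : Type*} [CommRing R] [IsNoetherianRing R] [AddCommGroup E] [Module R E]

theorem exists_le_linearPMap_domain_lt
    (h : ∀ P : Ideal R, P.IsPrime → ∃ J ≤ P, (∃ s ∉ P, ∀ p ∈ P, s * p ∈ J) ∧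
      ∀ g : J →ₗ[R] E, ∃ e : E, ∀ j : J, g j = (j : R) • e)
    (f : R →ₗ.[R] E) (hf : f.domain ≠ ⊤) :
    ∃ g : R →ₗ.[R] E, f ≤ g ∧ f.domain < g.domain := by
  have : Nontrivial (R ⧸ f.domain) := Submodule.Quotient.nontrivial_iff.mpr hf
  obtain ⟨P, hP⟩ := associatedPrimes.nonempty R (R ⧸ f.domain)
  rw [AssociatedPrimes.mem_iff, isAssociatedPrime_iff] at hP
  obtain ⟨hPp, c, hPc⟩ := hP
  obtain ⟨c, rfl⟩ := Submodule.mkQ_surjective _ c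
  have hmem : ∀ r : R, r ∈ P ↔ r * c ∈ f.domain := fun r ↦ by
    rw [hPc, Submodule.mem_colon_singleton, Submodule.mem_bot, ← map_smul,
      Submodule.mkQ_apply, Submodule.Quotient.mk_eq_zero, smul_eq_mul]
  obtain ⟨J, hJP, ⟨s, hs, hsP⟩, hext⟩ := h P hPp
  obtain ⟨e, he⟩ := hext (f.toFun ∘ₗ ((LinearMap.toSpanSingleton R R c ∘ₗ J.subtype).codRestrict
    f.domain fun j ↦ (hmem j).mp (hJP j.2)))
  replace he : ∀ j ∈ J, ∀ hjc : j * c ∈ f.domain, f ⟨j * c, hjc⟩ = j • e :=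
    fun j hj _ ↦ he ⟨j, hj⟩
  have hsc : s * c ∉ f.domain := fun hsc ↦ hs ((hmem s).mpr hsc)
  obtain ⟨g, hfg, hg⟩ := exists_le_linearPMap_mem_domain f (x := s * c) (y := s • e) fun r hr ↦ by
    rw [smul_eq_mul, ← mul_assoc] at hr
    have hrP : r ∈ P := (hPp.mem_or_mem ((hmem _).mpr hr)).resolve_right hs
    have hrs : r * s ∈ J := mul_comm s r ▸ hsP r hrP
    simp only [smul_eq_mul, smul_smul, ← he _ hrs hr, mul_assoc]
  exact ⟨g, hfg, lt_of_le_of_ne hfg.1 fun heq ↦ hsc (heq ▸ hg)⟩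

theorem baer_of_forall_isPrime_exists_ideal
    (h : ∀ P : Ideal R, P.IsPrime → ∃ J ≤ P, (∃ s ∉ P, ∀ p ∈ P, s * p ∈ J) ∧
      ∀ g : J →ₗ[R] E, ∃ e : E, ∀ j : J, g j = (j : R) • e) :
    Module.Baer R E := by
  intro I g
  obtain ⟨f, hgf, hmax⟩ := (InvImage.wf LinearPMap.domain wellFounded_gt).has_min
    (Set.Ici ⟨I, g⟩) Set.nonempty_Ici
  have htop : f.domain = ⊤ := by
    by_contra hf
    obtain ⟨f', hff', hlt⟩ := exists_le_linearPMap_domain_lt h f hf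
    exact hmax f' (hgf.trans hff') hlt
  refine ⟨f.toFun ∘ₗ (LinearEquiv.ofTop _ htop).symm.toLinearMap, fun x hx ↦ ?_⟩
  exact (hgf.2 (x := ⟨x, hx⟩) (y := ⟨x, htop ▸ Submodule.mem_top⟩) rfl).symm

end Baer

theorem exists_mem_notMem_of_forall_isPrime {R : Type*} [CommRing R] {P A : Ideal R}
    {s : Set (Ideal R)} (hs : s.Finite) (hprime : ∀ Q ∈ s, Q.IsPrime) (hA : ¬ P ≤ A)
    (hPs : ∀ Q ∈ s, ¬ P ≤ Q) : ∃ x ∈ P, x ∉ A ∧ ∀ Q ∈ s, x ∉ Q := by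
  by_contra! hcover
  have hsub : (P : Set R) ⊆ ⋃ Q ∈ insert A s, (Q : Set R) := fun x hx ↦ by
    by_cases hxA : x ∈ A
    · exact Set.mem_biUnion (Set.mem_insert A s) hxA
    · obtain ⟨Q, hQ, hxQ⟩ := hcover x hx hxA
      exact Set.mem_biUnion (Set.mem_insert_of_mem A hQ) hxQ
  obtain ⟨Q, rfl | hQ, hle⟩ := (Ideal.subset_union_prime_finite (hs.insert A) (f := id) A A
    fun Q hQ hne _ ↦ hprime Q (Set.mem_of_mem_insert_of_ne hQ hne)).mp hsub
  exacts [hA hle, hPs Q hQ hle]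

theorem spanFinrank_map_add_one_le {S S' M M' : Type*} [CommRing S] [IsLocalRing S] [CommRing S']
    {σ : S →+* S'} [RingHomSurjective σ] [AddCommGroup M] [Module S M] [AddCommGroup M']
    [Module S' M'] (f : M →ₛₗ[σ] M') {N : Submodule S M} (hN : N.FG) {x : M} (hx : x ∈ N)
    (hx' : x ∉ maximalIdeal S • N) (hfx : f x = 0) :
    (N.map f).spanFinrank + 1 ≤ N.spanFinrank := by
  classical
  obtain ⟨t, htcard, rfl⟩ := hN.exists_span_finset_card_eq_spanFinrank
  obtain ⟨d, -, rfl⟩ := Submodule.mem_span_finset.mp hx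
  obtain ⟨a, ha, hda⟩ : ∃ a ∈ t, IsUnit (d a) := by
    by_contra! hd
    exact hx' (sum_mem fun b hb ↦ Submodule.smul_mem_smul (hd b hb) (Submodule.subset_span hb))
  have hfa : f a ∈ Submodule.span S' (f '' (t.erase a)) := by
    rw [← Finset.add_sum_erase t _ ha, map_add, map_sum] at hfx
    rw [← Submodule.smul_mem_iff_of_isUnit _ (hda.map σ), ← map_smulₛₗ,
      eq_neg_of_add_eq_zero_left hfx]
    refine neg_mem (sum_mem fun b hb ↦ ?_)
    rw [map_smulₛₗ]
    exact Submodule.smul_mem _ _ (Submodule.subset_span ⟨b, hb, rfl⟩)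
  have hmap : (Submodule.span S (t : Set M)).map f = Submodule.span S' (f '' (t.erase a)) := by
    conv_lhs => rw [← Finset.insert_erase ha, Finset.coe_insert, Submodule.map_span,
      Set.image_insert_eq, Submodule.span_insert_eq_span hfa]
  rw [hmap, ← htcard, ← Finset.card_erase_add_one ha, ← Set.ncard_coe_finset]
  gcongr
  exact (Submodule.spanFinrank_span_le_ncard_of_finite (Set.toFinite _)).trans Set.ncard_image_le

section IsLocalRing

variable {S : Type*} [CommRing S] [IsLocalRing S]

theorem isLocalRing_quotient {I : Ideal S} (hI : I ≤ maximalIdeal S) : IsLocalRing (S ⧸ I) :=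
  have : Nontrivial (S ⧸ I) :=
    Ideal.Quotient.nontrivial_iff.mpr (ne_top_of_le_ne_top Ideal.IsPrime.ne_top' hI)
  .of_surjective' (Ideal.Quotient.mk I) Ideal.Quotient.mk_surjective

theorem comap_mk_maximalIdeal (I : Ideal S) [IsLocalRing (S ⧸ I)] :
    (maximalIdeal (S ⧸ I)).comap (Ideal.Quotient.mk I) = maximalIdeal S :=
  have := Ideal.Quotient.mk_surjective.isLocalHom (f := Ideal.Quotient.mk I)
  maximalIdeal_comap _

theorem map_mk_maximalIdeal (I : Ideal S) [IsLocalRing (S ⧸ I)] :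
    (maximalIdeal S).map (Ideal.Quotient.mk I) = maximalIdeal (S ⧸ I) := by
  rw [← comap_mk_maximalIdeal I, Ideal.map_comap_of_surjective _ Ideal.Quotient.mk_surjective]

variable [IsNoetherianRing S]

theorem maximalIdeal_le_of_le_sup_sq {J : Ideal S} (h : maximalIdeal S ≤ J ⊔ maximalIdeal S ^ 2) :
    maximalIdeal S ≤ J :=
  Submodule.le_of_le_smul_of_le_jacobson_bot (IsNoetherian.noetherian _)
    (maximalIdeal_le_jacobson _) (by rwa [smul_eq_mul, ← pow_two])

theorem spanFinrank_maximalIdeal_quotient_add_one_le {x : S} [IsLocalRing (S ⧸ Ideal.span {x})]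
    (hx : x ∈ maximalIdeal S) (hx' : x ∉ maximalIdeal S ^ 2) :
    (maximalIdeal (S ⧸ Ideal.span {x})).spanFinrank + 1 ≤ (maximalIdeal S).spanFinrank := by
  have : RingHomSurjective (Ideal.Quotient.mk (Ideal.span {x})) := ⟨Ideal.Quotient.mk_surjective⟩
  rw [← map_mk_maximalIdeal, Ideal.map_eq_submodule_map]
  exact spanFinrank_map_add_one_le _ (IsNoetherian.noetherian _) hx (by rwa [pow_two] at hx')
    (Ideal.Quotient.mk_singleton_self x)

theorem isDomain_of_isPrime_span_singleton {x : S} (hx : x ∈ maximalIdeal S)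
    [(Ideal.span {x}).IsPrime] (hmin : ∀ q ∈ minimalPrimes S, x ∉ q) : IsDomain S := by
  obtain ⟨q, hq, hqx⟩ := Ideal.exists_minimalPrimes_le (bot_le : ⊥ ≤ Ideal.span {x})
  have hqprime : q.IsPrime := hq.1.1
  -- Every element of `q` is a multiple `z * x`, and `x ∉ q` forces `z ∈ q`; hence `q = 𝔪 q`.
  have hq_le : q ≤ maximalIdeal S • q := fun y hy ↦ by
    obtain ⟨z, rfl⟩ := Ideal.mem_span_singleton.mp (hqx hy)
    exact Ideal.mul_mem_mul hx ((hqprime.mem_or_mem hy).resolve_left (hmin q hq))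
  obtain rfl : q = ⊥ := Submodule.eq_bot_of_le_smul_of_le_jacobson_bot _ _
    (IsNoetherian.noetherian q) hq_le (maximalIdeal_le_jacobson _)
  exact IsDomain.of_bot_isPrime S

end IsLocalRing

theorem isWeaklyRegular_cons_of_map_quotientMk {S : Type*} [CommRing S] {x : S}
    {rs : List S} (hx : IsSMulRegular S x)
    (hrs : IsWeaklyRegular (S ⧸ Ideal.span {x}) (rs.map (Ideal.Quotient.mk (Ideal.span {x})))) :
    IsWeaklyRegular S (x :: rs) := by
  have hrs' := (isWeaklyRegular_map_algebraMap_iff (S ⧸ Ideal.span {x}) (S ⧸ Ideal.span {x})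
    rs).mp hrs
  refine (isWeaklyRegular_cons_iff _ _ _).mpr
    ⟨hx, (LinearEquiv.isWeaklyRegular_congr (Submodule.quotEquivOfEq _ _ ?_) rs).mp hrs'⟩
  rw [← Submodule.ideal_span_singleton_smul, smul_eq_mul, Ideal.mul_top]

section IsRegularLocalRing

theorem height_maximalIdeal_eq_spanFinrank (S : Type*) [CommRing S] [IsRegularLocalRing S] :
    (maximalIdeal S).height = (maximalIdeal S).spanFinrank := by
  have h := maximalIdeal_height_eq_ringKrullDim (R := S)
  rw [← IsRegularLocalRing.spanFinrank_maximalIdeal] at h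
  exact_mod_cast h

variable {S : Type*} [CommRing S] [IsRegularLocalRing S]

theorem isRegularLocalRing_quotient_span_singleton {x : S} (hx : x ∈ maximalIdeal S)
    (hx' : x ∉ maximalIdeal S ^ 2) : IsRegularLocalRing (S ⧸ Ideal.span {x}) := by
  have := isLocalRing_quotient ((Ideal.span_singleton_le_iff_mem _).mpr hx)
  refine .of_spanFinrank_maximalIdeal_le _ (ENat.WithBot.add_le_add_one_right_iff.mp ?_)
  calc ((maximalIdeal (S ⧸ Ideal.span {x})).spanFinrank + 1 : WithBot ℕ∞)
    _ ≤ (maximalIdeal S).spanFinrank := by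
      exact_mod_cast spanFinrank_maximalIdeal_quotient_add_one_le hx hx'
    _ = (maximalIdeal S).height := by rw [height_maximalIdeal_eq_spanFinrank S]; rfl
    _ ≤ ringKrullDim (S ⧸ Ideal.span {x}) + 1 := Ideal.height_le_ringKrullDim_quotient_add_one hx

theorem spanFinrank_maximalIdeal_eq_quotient_add_one {x : S}
    [IsRegularLocalRing (S ⧸ Ideal.span {x})] (hx : x ∈ maximalIdeal S)
    (hx' : x ∉ maximalIdeal S ^ 2) :
    (maximalIdeal S).spanFinrank = (maximalIdeal (S ⧸ Ideal.span {x})).spanFinrank + 1 := by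
  refine le_antisymm ?_ (spanFinrank_maximalIdeal_quotient_add_one_le hx hx')
  have h := Ideal.height_le_ringKrullDim_quotient_add_one hx
  rw [height_maximalIdeal_eq_spanFinrank, ← IsRegularLocalRing.spanFinrank_maximalIdeal] at h
  exact_mod_cast h

theorem exists_mem_maximalIdeal_notMem_sq_notMem_minimalPrimes (h : maximalIdeal S ≠ ⊥) :
    ∃ x ∈ maximalIdeal S, x ∉ maximalIdeal S ^ 2 ∧ ∀ q ∈ minimalPrimes S, x ∉ q := by
  refine exists_mem_notMem_of_forall_isPrime (minimalPrimes.finite_of_isNoetherianRing S)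
    (fun q hq ↦ hq.1.1) (fun hle ↦ h ?_) fun q hq hle ↦ h ?_
  · exact le_bot_iff.mp (maximalIdeal_le_of_le_sup_sq (by rwa [bot_sup_eq]))
  · have hqprime : q.IsPrime := hq.1.1
    have hheight : (maximalIdeal S).height = 0 :=
      le_zero_iff.mp ((Ideal.height_mono hle).trans_eq (Ideal.height_eq_zero_iff.mpr hq))
    rw [height_maximalIdeal_eq_spanFinrank, Nat.cast_eq_zero] at hheight
    exact (Submodule.spanFinrank_eq_zero_iff_eq_bot (IsNoetherian.noetherian _)).mp hheight

variable (S) in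
theorem isDomain_of_isRegularLocalRing : IsDomain S := by
  induction hn : (maximalIdeal S).spanFinrank generalizing S with
  | zero =>
    have hbot : maximalIdeal S = ⊥ :=
      (Submodule.spanFinrank_eq_zero_iff_eq_bot (IsNoetherian.noetherian _)).mp hn
    exact (isField_iff_maximalIdeal_eq.mpr hbot).isDomain
  | succ n ih =>
    obtain ⟨x, hx, hx', hmin⟩ := exists_mem_maximalIdeal_notMem_sq_notMem_minimalPrimes (S := S)
      fun h ↦ by simp [h] at hn
    have := isRegularLocalRing_quotient_span_singleton hx hx'
    have := ih (S := S ⧸ Ideal.span {x})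
      (Nat.succ_injective ((spanFinrank_maximalIdeal_eq_quotient_add_one hx hx').symm.trans hn))
    have := (Ideal.Quotient.isDomain_iff_prime (Ideal.span {x})).mp this
    exact isDomain_of_isPrime_span_singleton hx hmin

variable (S) in
theorem exists_isRegular_length_eq_spanFinrank :
    ∃ rs : List S, rs.length = (maximalIdeal S).spanFinrank ∧ (∀ r ∈ rs, r ∈ maximalIdeal S) ∧
      IsRegular S rs := by
  induction hn : (maximalIdeal S).spanFinrank generalizing S with
  | zero => exact ⟨[], rfl, by simp, .nil S S⟩
  | succ n ih =>
    obtain ⟨x, hx, hx', -⟩ := exists_mem_maximalIdeal_notMem_sq_notMem_minimalPrimes (S := S)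
      fun h ↦ by simp [h] at hn
    have := isRegularLocalRing_quotient_span_singleton hx hx'
    obtain ⟨rs, hlen, hmem, hrs⟩ := ih (S := S ⧸ Ideal.span {x})
      (Nat.succ_injective ((spanFinrank_maximalIdeal_eq_quotient_add_one hx hx').symm.trans hn))
    obtain ⟨rs, rfl⟩ := List.map_surjective_iff.mpr Ideal.Quotient.mk_surjective rs
    have hmem' : ∀ r ∈ x :: rs, r ∈ maximalIdeal S := by
      refine List.forall_mem_cons.mpr ⟨hx, fun r hr ↦ ?_⟩
      rw [← comap_mk_maximalIdeal (Ideal.span {x})]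
      exact hmem _ (List.mem_map_of_mem hr)
    have := isDomain_of_isRegularLocalRing S
    have hx0 : x ≠ 0 := by
      rintro rfl
      exact hx' (zero_mem _)
    exact ⟨x :: rs, by simpa using hlen, hmem', .of_isWeaklyRegular_of_mem_maximalIdeal S hmem'
      (isWeaklyRegular_cons_of_map_quotientMk (IsSMulRegular.of_ne_zero hx0) hrs.toIsWeaklyRegular)⟩

end IsRegularLocalRing

theorem subsingleton_linearMap_quotient_of_subsingleton_ext {R : Type u} [CommRing R]
    {N M : ModuleCat.{u} R} {n : ℕ} {rs : List R} (hrs : IsWeaklyRegular M rs)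
    (hn : rs.length < n) (hext : ∀ i < n, Subsingleton (Ext N M i)) :
    Subsingleton (N →ₗ[R] M ⧸ (Ideal.ofList rs • ⊤ : Submodule R M)) := by
  induction rs generalizing M n with
  | nil =>
    have : Subsingleton (N ⟶ M) := Ext.addEquiv₀.subsingleton_congr.mp (hext 0 hn)
    have : Subsingleton (N →ₗ[R] M) := ModuleCat.homAddEquiv.symm.subsingleton
    exact (LinearEquiv.congrRight (Submodule.quotEquivOfEqBot _ (by simp)) :
      (N →ₗ[R] _) ≃ₗ[R] (N →ₗ[R] M)).toEquiv.subsingleton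
  | cons x rs ih =>
    rw [isWeaklyRegular_cons_iff] at hrs
    obtain ⟨n, rfl⟩ := Nat.exists_eq_add_one_of_ne_zero (Nat.ne_zero_of_lt hn)
    have hext' : ∀ i < n, Subsingleton (Ext N (ModuleCat.of R (QuotSMulTop x M)) i) := by
      intro i hi
      have zero₁ := AddCommGrpCat.isZero_of_iff_subsingleton.mpr (hext i (by lia))
      have zero₂ := AddCommGrpCat.isZero_of_iff_subsingleton.mpr (hext (i + 1) (by lia))
      exact AddCommGrpCat.subsingleton_of_isZero <| ShortComplex.Exact.isZero_of_both_zeros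
        ((Ext.covariant_sequence_exact₃' N hrs.1.smulShortComplex_shortExact) i (i + 1) rfl)
        (zero₁.eq_zero_of_src _) (zero₂.eq_zero_of_tgt _)
    have := ih hrs.2 (Nat.lt_of_succ_lt_succ hn) hext'
    exact (LinearEquiv.congrRight
      (Submodule.quotOfListConsSMulTopEquivQuotSMulTopInner M x rs)).toEquiv.subsingleton

theorem maximalIdeal_notMem_associatedPrimes_of_length_lt {S : Type u} [CommRing S] [IsLocalRing S]
    [IsNoetherianRing S] {M : Type u} [AddCommGroup M] [Module S M] [Module.Finite S M]
    {rs xs : List S} (hrs : IsRegular M rs) (hmem : ∀ r ∈ rs, r ∈ maximalIdeal S)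
    (hxs : IsWeaklyRegular M xs) (hlt : xs.length < rs.length) :
    maximalIdeal S ∉ associatedPrimes S (M ⧸ (Ideal.ofList xs • ⊤ : Submodule S M)) := by
  intro hass
  have : Nontrivial M := hrs.nontrivial
  have hext := ModuleCat.subsingleton_ext_of_exists_isRegular (maximalIdeal S)
    (ModuleCat.of S (S ⧸ maximalIdeal S))
    (by rw [Module.support_eq_zeroLocus, Ideal.annihilator_quotient])
    (ModuleCat.of S M)
    (lt_top_iff_ne_top.mpr (Submodule.top_ne_ideal_smul_of_le_jacobson_annihilator
      (maximalIdeal_le_jacobson _)).symm) rs hmem hrs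
  have hsub : Subsingleton ((S ⧸ maximalIdeal S) →ₗ[S] M ⧸ (Ideal.ofList xs • ⊤ : Submodule S M)) :=
    subsingleton_linearMap_quotient_of_subsingleton_ext (N := ModuleCat.of S (S ⧸ maximalIdeal S))
      (M := ModuleCat.of S M) hxs hlt hext
  rw [AssociatedPrimes.mem_iff, isAssociatedPrime_iff_exists_injective_linearMap] at hass
  obtain ⟨-, f, hf⟩ := hass
  have hone : f 1 = f 0 := by rw [hsub.elim f 0, LinearMap.zero_apply, LinearMap.zero_apply]
  exact one_ne_zero (hf hone)

theorem height_le_length_of_mem_associatedPrimes {R : Type u} [CommRing R] [IsRegularRing R]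
    {Q : Ideal R} {xs : List R} (hxs : IsWeaklyRegular R xs)
    (hQ : Q ∈ associatedPrimes R (R ⧸ Ideal.ofList xs)) : Q.height ≤ xs.length := by
  have hQprime : Q.IsPrime := hQ.1
  let S := Localization.AtPrime Q
  by_contra! hlt
  obtain ⟨rs, hlen, hmem, hrs⟩ := exists_isRegular_length_eq_spanFinrank S
  have hlt' : (xs.map (algebraMap R S)).length < rs.length := by
    rw [← Localization.AtPrime.under_maximalIdeal (I := Q),
      IsLocalization.height_under Q.primeCompl, height_maximalIdeal_eq_spanFinrank] at hlt
    rw [List.length_map, hlen]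
    exact_mod_cast hlt
  refine maximalIdeal_notMem_associatedPrimes_of_length_lt hrs hmem
    (hxs.of_isLocalization S Q.primeCompl) hlt' ?_
  rw [smul_eq_mul, Ideal.mul_top, ← Ideal.map_ofList, ← Ideal.localized'_eq_map S Q.primeCompl]
  open Module.associatedPrimes in
  refine mem_associatedPrimes_of_comap_mem_associatedPrimes_of_isLocalizedModule Q.primeCompl
    (Submodule.toLocalizedQuotient' S Q.primeCompl (Algebra.linearMap R S) (Ideal.ofList xs)) _ ?_
  rwa [← Ideal.under_def, Localization.AtPrime.under_maximalIdeal]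

theorem exists_mem_forall_mul_mem_of_map_le {R S : Type*} [CommRing R] [CommRing S] [Algebra R S]
    (M : Submonoid R) [IsLocalization M S] {I J : Ideal R} (hI : I.FG)
    (h : I.map (algebraMap R S) ≤ J.map (algebraMap R S)) : ∃ s ∈ M, ∀ p ∈ I, s * p ∈ J := by
  induction I, hI using Submodule.fg_induction with
  | singleton x =>
    obtain ⟨s, hs, hsx⟩ := (IsLocalization.algebraMap_mem_map_algebraMap_iff M S J x).mp
      (h (Ideal.mem_map_of_mem _ (Ideal.mem_span_singleton_self x)))
    refine ⟨s, hs, fun p hp ↦ ?_⟩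
    obtain ⟨r, rfl⟩ := Ideal.mem_span_singleton.mp hp
    rw [← mul_assoc]
    exact J.mul_mem_right r hsx
  | sup I₁ I₂ _ _ ih₁ ih₂ =>
    obtain ⟨s₁, hs₁, h₁⟩ := ih₁ ((Ideal.map_mono le_sup_left).trans h)
    obtain ⟨s₂, hs₂, h₂⟩ := ih₂ ((Ideal.map_mono le_sup_right).trans h)
    refine ⟨s₁ * s₂, M.mul_mem hs₁ hs₂, fun p hp ↦ ?_⟩
    obtain ⟨a, ha, b, hb, rfl⟩ := Submodule.mem_sup.mp hp
    rw [mul_add, mul_right_comm s₁ s₂ a, mul_assoc s₁ s₂ b]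
    exact add_mem (J.mul_mem_right _ (h₁ a ha)) (J.mul_mem_left _ (h₂ b hb))

theorem spanFinrank_map_mkQ_sup_span_singleton_add_one_le {S M : Type*} [CommRing S]
    [IsLocalRing S] [AddCommGroup M] [Module S M] {K N : Submodule S M} (hN : N.FG) {x : M}
    (hx : x ∈ N) (hx' : x ∉ K ⊔ maximalIdeal S • N) :
    (N.map (K ⊔ Submodule.span S {x}).mkQ).spanFinrank + 1 ≤ (N.map K.mkQ).spanFinrank := by
  have hxK : K.mkQ x ∉ maximalIdeal S • N.map K.mkQ := by
    rwa [← Submodule.map_smul'', ← Submodule.mem_comap, Submodule.comap_map_mkQ]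
  rw [← Submodule.factor_comp_mk (le_sup_left : K ≤ K ⊔ Submodule.span S {x}), Submodule.map_comp]
  refine spanFinrank_map_add_one_le _ (hN.map _) (Submodule.mem_map_of_mem hx) hxK ?_
  rw [Submodule.factor_mk, Submodule.mkQ_apply, Submodule.Quotient.mk_eq_zero]
  exact Submodule.mem_sup_right (Submodule.mem_span_singleton_self x)

section IsRegularRing

variable {R : Type u} [CommRing R] [IsRegularRing R] {P : Ideal R} [P.IsPrime]
  (S : Type*) [CommRing S] [IsLocalRing S] [Algebra R S] [IsLocalization.AtPrime S P]

theorem exists_isSMulRegular_notMem_sup_sq {xs : List R} (hxs : IsWeaklyRegular R xs)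
    (hlt : xs.length < P.height) (hP : ¬ maximalIdeal S ≤ (Ideal.ofList xs).map (algebraMap R S)) :
    ∃ x ∈ P, IsSMulRegular (R ⧸ Ideal.ofList xs) x ∧
      algebraMap R S x ∉ (Ideal.ofList xs).map (algebraMap R S) ⊔ maximalIdeal S ^ 2 := by
  have := IsLocalization.isNoetherianRing P.primeCompl S inferInstance
  obtain ⟨x, hxP, hx, hxass⟩ := exists_mem_notMem_of_forall_isPrime (P := P)
    (A := ((Ideal.ofList xs).map (algebraMap R S) ⊔ maximalIdeal S ^ 2).comap (algebraMap R S))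
    (associatedPrimes.finite R (R ⧸ Ideal.ofList xs)) (fun Q hQ ↦ hQ.1)
    (fun hle ↦ hP (maximalIdeal_le_of_le_sup_sq (by
      rwa [← Ideal.map_le_iff_le_comap, IsLocalization.AtPrime.map_eq_maximalIdeal P S] at hle)))
    (fun Q hQ hle ↦ hlt.not_ge ((Ideal.height_mono hle).trans
      (height_le_length_of_mem_associatedPrimes hxs hQ)))
  refine ⟨x, hxP, ?_, hx⟩
  have hx' : x ∉ ⋃ Q ∈ associatedPrimes R (R ⧸ Ideal.ofList xs), (Q : Set R) := by
    simpa only [Set.mem_iUnion, not_exists, SetLike.mem_coe] using hxass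
  rwa [biUnion_associatedPrimes_eq_compl_regular, Set.notMem_compl_iff] at hx'

theorem exists_isWeaklyRegular_maximalIdeal_le_map {n : ℕ} {xs : List R} (hmem : ∀ x ∈ xs, x ∈ P)
    (hxs : IsWeaklyRegular R xs) (hn : (xs.length + n : ℕ) ≤ P.height)
    (hrank : (Submodule.map ((Ideal.ofList xs).map (algebraMap R S)).mkQ
      (maximalIdeal S)).spanFinrank ≤ n) :
    ∃ ys : List R, (∀ y ∈ ys, y ∈ P) ∧ IsWeaklyRegular R ys ∧
      maximalIdeal S ≤ (Ideal.ofList ys).map (algebraMap R S) := by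
  have := IsLocalization.isNoetherianRing P.primeCompl S inferInstance
  induction n generalizing xs with
  | zero =>
    refine ⟨xs, hmem, hxs, ?_⟩
    rw [Nat.le_zero, Submodule.spanFinrank_eq_zero_iff_eq_bot ((IsNoetherian.noetherian _).map _),
      ← LinearMap.le_ker_iff_map, Submodule.ker_mkQ] at hrank
    exact hrank
  | succ n ih =>
    by_cases hP : maximalIdeal S ≤ (Ideal.ofList xs).map (algebraMap R S)
    · exact ⟨xs, hmem, hxs, hP⟩
    obtain ⟨x, hxP, hxreg, hx⟩ := exists_isSMulRegular_notMem_sup_sq S hxs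
      (lt_of_lt_of_le (by norm_cast; lia) hn) hP
    have hx𝔪 : algebraMap R S x ∈ maximalIdeal S := by
      rw [← IsLocalization.AtPrime.map_eq_maximalIdeal P S]
      exact Ideal.mem_map_of_mem _ hxP
    refine ih (xs := xs ++ [x]) ?_ ?_ ?_ ?_
    · simpa only [List.forall_mem_append, List.forall_mem_singleton] using ⟨hmem, hxP⟩
    · rw [isWeaklyRegular_append_iff, isWeaklyRegular_singleton_iff, smul_eq_mul, Ideal.mul_top]
      exact ⟨hxs, hxreg⟩
    · rwa [List.length_append, List.length_singleton, add_assoc, add_comm 1]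
    · rw [Ideal.ofList_append, Ideal.ofList_singleton, Ideal.map_sup, Ideal.map_span _ {x},
        Set.image_singleton]
      exact Nat.le_of_succ_le_succ ((spanFinrank_map_mkQ_sup_span_singleton_add_one_le
        (IsNoetherian.noetherian _) hx𝔪 (by rwa [smul_eq_mul, ← pow_two])).trans hrank)

theorem exists_isRegular_forall_mul_mem_ofList (P : Ideal R) [P.IsPrime] :
    ∃ xs : List R, IsRegular R xs ∧ Ideal.ofList xs ≤ P ∧
      ∃ s ∉ P, ∀ p ∈ P, s * p ∈ Ideal.ofList xs := by
  let S := Localization.AtPrime P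
  have hheight : ((maximalIdeal S).spanFinrank : ℕ∞) = P.height := by
    rw [← height_maximalIdeal_eq_spanFinrank, ← IsLocalization.height_under P.primeCompl,
      Localization.AtPrime.under_maximalIdeal]
  obtain ⟨xs, hmem, hxs, hle⟩ := exists_isWeaklyRegular_maximalIdeal_le_map (P := P) (xs := []) S
    (by simp) (.nil R R) (by rw [List.length_nil, zero_add]; exact hheight.le)
    (Submodule.spanFinrank_map_le_of_fg _ (IsNoetherian.noetherian _))
  have hxsP : Ideal.ofList xs ≤ P := Ideal.span_le.mpr hmem
  rw [← Localization.AtPrime.map_eq_maximalIdeal] at hle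
  refine ⟨xs, ⟨hxs, fun h ↦ ?_⟩, hxsP,
    exists_mem_forall_mul_mem_of_map_le P.primeCompl (IsNoetherian.noetherian P) hle⟩
  rw [smul_eq_mul, Ideal.mul_top] at h
  exact Ideal.IsPrime.ne_top' (top_le_iff.mp (h.trans_le hxsP))

end IsRegularRing

theorem lemma2 {R : Type u} [CommRing R] [IsRegularRing R]
    {E : Type u} [AddCommGroup E] [Module R E]
    (hE : ∀ J : Ideal R,
      (∃ rs : List R, RingTheory.Sequence.IsRegular R rs ∧ J = Ideal.ofList rs) →
      Subsingleton (CategoryTheory.Abelian.Ext (ModuleCat.of R (R ⧸ J)) (ModuleCat.of R E) 1)) :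
    Module.Injective R E := by
  refine Module.Baer.injective (baer_of_forall_isPrime_exists_ideal fun P _ ↦ ?_)
  obtain ⟨xs, hxs, hle, hs⟩ := exists_isRegular_forall_mul_mem_ofList P
  exact ⟨Ideal.ofList xs, hle, hs,
    exists_forall_eq_smul_of_subsingleton_ext_one (hE _ ⟨xs, hxs, rfl⟩)⟩
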